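/- Work over $\mathbb{C}$. For every pair $(t,\delta)$ of positive integers there exist homogeneous polynomials $F,G\in\mathbb{C}[x_0,\dots,x_4]$ of degree $\delta t$ such that $f=x_0F+x_1G$ is irreducible, homogeneous of degree $d=\delta t+1$, and the hypersurface $X=V(f)\subset\mathbb{P}^4$ (whose homogeneous ideal is $I_X=(f)$, so that $X$ has degree $d$) has the following properties: (i) $X$ is not factorial, that is, its homogeneous coordinate ring $\mathbb{C}[x_0,\dots,x_4]/I_X$ is not a unique factorization domain; (ii) the singular locus of $X$ consists of exactly $k=\delta^2$ points, and each of them is an ordinary $m$-ple point of $X$ with $m=t+1$, that is, the tangent cone of $X$ at the point is a cone over a smooth surface of degree $m$ in $\mathbb{P}^3$; (iii) $X$ contains the plane $\{x_0=x_1=0\}$. -/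

import Mathlib

open MvPolynomial
open scoped LinearAlgebra.Projectivization

noncomputable section

/-- The complex projective space of dimension `n`. -/
abbrev ProjSpace (n : ℕ) : Type := ℙ ℂ (Fin (n + 1) → ℂ)

/-- The zero set in projective space of a polynomial `f` (meant for homogeneous `f`, when the
condition does not depend on the chosen representative). -/
def hypersurface {n : ℕ} (f : MvPolynomial (Fin (n + 1)) ℂ) : Set (ProjSpace n) :=
  {p | eval p.rep f = 0}

/-- The homogeneous ideal of `X`: the polynomials that vanish on the affine cone over `X`, the
union of the lines that are the points of `X`. -/
def homogeneousIdeal {n : ℕ} (X : Set (ProjSpace n)) : Ideal (MvPolynomial (Fin (n + 1)) ℂ) :=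
  MvPolynomial.vanishingIdeal ℂ {v : Fin (n + 1) → ℂ | ∃ p ∈ X, v ∈ p.submodule}

/-- The homogeneous coordinate ring of `X`. -/
abbrev homogeneousCoordinateRing {n : ℕ} (X : Set (ProjSpace n)) : Type :=
  MvPolynomial (Fin (n + 1)) ℂ ⧸ homogeneousIdeal X

/-- A projective variety is factorial if its homogeneous coordinate ring is a UFD. -/
def IsFactorialVariety {n : ℕ} (X : Set (ProjSpace n)) : Prop :=
  UniqueFactorizationMonoid (homogeneousCoordinateRing X)

/-- The singular points of the hypersurface with equation `f` (a generator of its homogeneous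
ideal), by the Jacobian criterion. -/
def singularLocus {n : ℕ} (f : MvPolynomial (Fin (n + 1)) ℂ) : Set (ProjSpace n) :=
  {p | p ∈ hypersurface f ∧ ∀ i, eval p.rep (pderiv i f) = 0}

/-- `g` is a nonzero form of degree `m` that defines a smooth hypersurface of degree `m` in the
projective space with homogeneous coordinates indexed by `σ`. -/
def IsSmoothForm {σ : Type} (g : MvPolynomial σ ℂ) (m : ℕ) : Prop :=
  g.IsHomogeneous m ∧ g ≠ 0 ∧
    ∀ v : σ → ℂ, v ≠ 0 → eval v g = 0 → ∃ i, eval v (pderiv i g) ≠ 0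

/-- The equation, in the affine chart `x_i = 1` with coordinates translated so that the point
`[v]` (where `v i ≠ 0`) becomes the origin, of the hypersurface with equation `f`. -/
def localEquation {n : ℕ} (f : MvPolynomial (Fin (n + 1)) ℂ) (v : Fin (n + 1) → ℂ)
    (i : Fin (n + 1)) : MvPolynomial {j : Fin (n + 1) // j ≠ i} ℂ :=
  aeval (fun j => if h : j = i then 1 else X ⟨j, h⟩ + C (v j / v i)) f

/-- `p` is an ordinary `m`-ple point of the hypersurface with equation `f`: in an affine chart
around `p` the terms of degree `< m` of the local equation vanish and those of degree `m`, the
equation of the tangent cone at `p`, define a smooth hypersurface of degree `m` in the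
projectivized tangent space (a smooth surface in projective 3-space when `n = 4`). For homogeneous
`f` the choice of the chart does not matter. -/
def IsOrdinaryPoint {n : ℕ} (f : MvPolynomial (Fin (n + 1)) ℂ) (m : ℕ) (p : ProjSpace n) :
    Prop :=
  0 < m ∧ ∃ i, p.rep i ≠ 0 ∧
    (∀ l < m, homogeneousComponent l (localEquation f p.rep i) = 0) ∧
    IsSmoothForm (homogeneousComponent m (localEquation f p.rep i)) m

end

/-! Write `n = δ - 1`, `P(x,y,s) = (y^δ - s^δ)^t + x^t (x^(nt) + c s^(nt))`, and take `F =
P(x₀,x₂,x₄)`, `G = μ P(x₁,x₃,x₄)`. Up to the shared variable `x₄`, `f` is a sum of two polynomials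
in separate variables, so at a singular point each summand is critical in its own two variables.
Where `x₀` or `x₁` is nonzero, `f = 0` forces a relation among finitely many nonzero critical
values, which a generic `μ` excludes (`pencilThreefold_singular_iff`). On the plane the singular
points are `F = G = 0`: pairs of `δ`-th roots of unity, hence `δ²` points. There the tangent cone is
`a x y^t + b x^(t+1) + a' x' y'^t + b' x'^(t+1)`, which is smooth (`isSmoothForm_tangentCone`).

`f` is monic in `x₀` and has an Eisenstein specialization, so it is irreducible. The plane is a
divisor not cut out by one equation, so factoriality fails
(`not_uniqueFactorizationMonoid_quotient`). -/

theorem MvPolynomial.IsHomogeneous.eval_smul_eq {σ R : Type*} [CommSemiring R]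
    {f : MvPolynomial σ R} {d : ℕ} (hf : f.IsHomogeneous d) (a : R) (v : σ → R) :
    eval (a • v) f = a ^ d * eval v f := by
  rw [eval_eq, eval_eq, Finset.mul_sum]
  refine Finset.sum_congr rfl fun m hm => ?_
  have h := hf.degree_eq_sum_deg_support hm
  simp only [Pi.smul_apply, smul_eq_mul, mul_pow, Finset.prod_mul_distrib, Finset.prod_pow_eq_pow_sum]
  rw [h]
  ring

/-! ### The homogeneous ideal and non-factoriality -/

theorem homogeneousIdeal_hypersurface {n d : ℕ} {f : MvPolynomial (Fin (n + 1)) ℂ}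
    (hf : f.IsHomogeneous d) (hirr : Irreducible f)
    (hne : (hypersurface f).Nonempty) :
    homogeneousIdeal (hypersurface f) = Ideal.span {f} := by
  have hcone : {v : Fin (n + 1) → ℂ | ∃ p ∈ hypersurface f, v ∈ p.submodule} =
      zeroLocus ℂ (Ideal.span {f}) := by
    rw [zeroLocus_span]
    ext v
    have hae : ∀ w, aeval w f = eval w f := fun w => RingHom.congr_fun (coe_aeval_eq_eval w) f
    simp only [Set.mem_ofPred_eq, Set.mem_singleton_iff, forall_eq, hae]
    constructor
    · rintro ⟨p, hp, hv⟩
      rw [Projectivization.submodule_eq, Submodule.mem_span_singleton] at hv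
      obtain ⟨a, rfl⟩ := hv
      rw [hf.eval_smul_eq, show eval p.rep f = 0 from hp, mul_zero]
    · intro hv
      -- The origin lies in the cone only if the hypersurface has a point; this is where `hne` is
      -- needed.
      by_cases h0 : v = 0
      · obtain ⟨p, hp⟩ := hne
        exact ⟨p, hp, h0 ▸ Submodule.zero_mem _⟩
      · refine ⟨Projectivization.mk ℂ v h0, ?_, ?_⟩
        · obtain ⟨a, ha⟩ := Projectivization.exists_smul_eq_mk_rep ℂ v h0
          show eval _ f = 0
          rw [← ha, Units.smul_def, hf.eval_smul_eq, hv, mul_zero]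
        · rw [Projectivization.submodule_mk]
          exact Submodule.mem_span_singleton_self v
  rw [homogeneousIdeal, hcone, vanishingIdeal_zeroLocus_eq_radical]
  exact ((Ideal.span_singleton_prime hirr.ne_zero).2 hirr.prime).radical

/-- If a polynomial with vanishing linear part at the origin is `x_i F + x_j G` and `G` does not vanish
identically on `x_i = x_j = 0`, then the quotient by it is not factorial: the subspace
`x_i = x_j = 0` is a divisor that is not cut out by one equation. -/
theorem not_uniqueFactorizationMonoid_quotient {σ K : Type*} [Field K]
    {f F G : MvPolynomial σ K} {i j : σ} (hij : i ≠ j) (hf : f = X i * F + X j * G)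
    (hf0 : eval 0 f = 0) (hf1 : ∀ k, eval 0 (pderiv k f) = 0)
    (ρ : MvPolynomial σ K →ₐ[K] MvPolynomial σ K) (hi : ρ (X i) = 0) (hj : ρ (X j) = 0)
    (hG : ρ G ≠ 0) (hρ : ∀ g, ρ g = 0 → eval 0 g = 0) :
    ¬ UniqueFactorizationMonoid (MvPolynomial σ K ⧸ Ideal.span {f}) := by
  classical
  intro hU
  let π : MvPolynomial σ K →+* MvPolynomial σ K ⧸ Ideal.span {f} := Ideal.Quotient.mk _
  have hρf : ρ f = 0 := by rw [hf]; simp [hi, hj]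
  let ρ' : MvPolynomial σ K ⧸ Ideal.span {f} →+* MvPolynomial σ K :=
    Ideal.Quotient.lift _ ρ.toRingHom (by
      intro a ha
      obtain ⟨b, rfl⟩ := Ideal.mem_span_singleton.1 ha
      simp [hρf])
  have hρ' : ∀ g, ρ' (π g) = ρ g := fun g => rfl
  -- Modulo `f`, which has no linear part, a multiple of a `g` vanishing at the origin has linear
  -- part proportional to that of `g`.
  have hlin : ∀ a b g h : MvPolynomial σ K, ρ g = 0 → a = b * g + f * h → ∀ k,
      eval 0 (pderiv k a) = eval 0 b * eval 0 (pderiv k g) := by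
    intro a b g h hg ha k
    rw [ha]
    simp only [map_add, Derivation.leibniz, smul_eq_mul, map_mul, hf0, hf1, hρ g hg]
    ring
  have hker : ∀ a, π a = 0 → ∃ h, a = f * h := fun a ha =>
    Ideal.mem_span_singleton.1 (Ideal.Quotient.eq_zero_iff_mem.1 ha)
  have hXi : π (X i) ≠ 0 := by
    intro h
    obtain ⟨k, hk⟩ := hker _ h
    have := hlin (X i) 0 0 k (map_zero _) (by rw [hk]; ring) i
    simp at this
  obtain ⟨s, hs, u, hu⟩ := UniqueFactorizationMonoid.exists_prime_factors _ hXi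
  -- Restriction to the subspace kills `X i` and lands in a domain, so it kills one of its prime
  -- factors `q`.
  have hprod : ρ' s.prod = 0 := by
    have h1 : ρ' s.prod * ρ' u = 0 := by rw [← map_mul, hu, hρ', hi]
    exact (mul_eq_zero.1 h1).resolve_right ((u.isUnit.map ρ').ne_zero)
  rw [map_multiset_prod, Multiset.prod_eq_zero_iff, Multiset.mem_map] at hprod
  obtain ⟨q, hqs, hq⟩ := hprod
  have hqi : q ∣ π (X i) := hu ▸ (Multiset.dvd_prod hqs).mul_right _
  have hqjG : q ∣ π (X j) * π G := by
    have h : π (X i) * π F + π (X j) * π G = 0 := by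
      rw [← map_mul, ← map_mul, ← map_add, ← hf]
      exact Ideal.Quotient.eq_zero_iff_mem.2 (Ideal.mem_span_singleton_self f)
    rw [eq_neg_of_add_eq_zero_right h]
    exact (hqi.mul_right _).neg_right
  obtain ⟨g, rfl⟩ := Ideal.Quotient.mk_surjective q
  have hlift : ∀ k, π g ∣ π (X k) → ∃ b h, X k = b * g + f * h := by
    rintro k ⟨b, hb⟩
    obtain ⟨b, rfl⟩ := Ideal.Quotient.mk_surjective b
    obtain ⟨h, hh⟩ := hker (X k - b * g) (by
      rw [map_sub, map_mul, hb]
      exact sub_eq_zero.2 (mul_comm _ _))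
    exact ⟨b, h, by rw [← hh]; ring⟩
  rcases (hs _ hqs).dvd_or_dvd hqjG with h | ⟨w, hw⟩
  -- If `q` divides both `X i` and `X j`, these two independent linear forms are proportional to one
  -- linear part.
  · obtain ⟨b, h1, hb⟩ := hlift i hqi
    obtain ⟨b', h2, hb'⟩ := hlift j h
    have e1 := hlin _ _ _ _ hq hb i
    have e2 := hlin _ _ _ _ hq hb' i
    have e3 := hlin _ _ _ _ hq hb' j
    simp only [pderiv_X_self, map_one, pderiv_X_of_ne hij.symm, map_zero] at e1 e2 e3
    rcases mul_eq_zero.1 e2.symm with h | h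
    · rw [h, zero_mul] at e3; exact one_ne_zero e3
    · rw [h, mul_zero] at e1; exact one_ne_zero e1
  · apply hG
    rw [← hρ', hw, map_mul]
    exact mul_eq_zero_of_left hq _

/-! ### Lowest-degree components of products -/

theorem MvPolynomial.homogeneousComponent_mul_of_lt {σ R : Type*} [CommSemiring R]
    {h : MvPolynomial σ R} {m l : ℕ} (hh : h.IsHomogeneous m) (w : MvPolynomial σ R) (hl : l < m) :
    homogeneousComponent l (h * w) = 0 := by
  let _ : GradedAlgebra (homogeneousSubmodule σ R) := gradedAlgebra
  rw [← decomposition.decompose'_apply]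
  exact DirectSum.coe_decompose_mul_of_left_mem_of_not_le (homogeneousSubmodule σ R) hh hl.not_ge

theorem MvPolynomial.homogeneousComponent_mul_self {σ R : Type*} [CommSemiring R]
    {h : MvPolynomial σ R} {m : ℕ} (hh : h.IsHomogeneous m) (w : MvPolynomial σ R) :
    homogeneousComponent m (h * w) = h * C (eval 0 w) := by
  let _ : GradedAlgebra (homogeneousSubmodule σ R) := gradedAlgebra
  rw [← decomposition.decompose'_apply]
  refine (DirectSum.coe_decompose_mul_of_left_mem_of_le
    (homogeneousSubmodule σ R) hh le_rfl).trans ?_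
  have : ((DirectSum.decompose (homogeneousSubmodule σ R) w) (m - m) : MvPolynomial σ R) =
    homogeneousComponent (m - m) w := decomposition.decompose'_apply w _
  rw [this, Nat.sub_self, homogeneousComponent_zero, ← constantCoeff_eq]
  simp

/-! ### Pencil forms and their critical values -/

/-- The form `(y^δ - s^δ)^t + x^t (x^e + c s^e)` of degree `δ t`, where `δ = n + 1`, `e = n t`. -/
def pencilForm {R : Type*} [CommRing R] (t n : ℕ) (c x y s : R) : R :=
  (y ^ (n + 1) - s ^ (n + 1)) ^ t + x ^ t * (x ^ (n * t) + c * s ^ (n * t))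

theorem map_pencilForm {R S A : Type*} [CommRing R] [CommRing S] [FunLike A R S]
    [RingHomClass A R S] (φ : A) (t n : ℕ) (c x y s : R) :
    φ (pencilForm t n c x y s) = pencilForm t n (φ c) (φ x) (φ y) (φ s) := by
  simp [pencilForm]

theorem isHomogeneous_pencilForm {σ R : Type*} [CommRing R] (t n : ℕ) (c : R) (i j k : σ) :
    (pencilForm t n (C c) (X i) (X j) (X k)).IsHomogeneous ((n + 1) * t) := by
  have h1 := (((isHomogeneous_X_pow (R := R) j (n + 1)).sub (isHomogeneous_X_pow k (n + 1))).pow t)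
  have h2 := (isHomogeneous_X_pow (R := R) i t).mul
    ((isHomogeneous_X_pow i (n * t)).add (isHomogeneous_C_mul_X_pow c k (n * t)))
  rw [show t + n * t = (n + 1) * t by ring] at h2
  exact h1.add h2

/-- The critical values at nonzero points of `α x + x^(e+t+1) + c x^(t+1)`, where `e = n t`, for
the two values `0` and `(-1)^t` of `α`. -/
def nonzeroCriticalValues (t n : ℕ) (c : ℂ) : Set ℂ :=
  {z | ∃ x α : ℂ, x ≠ 0 ∧ (α = 0 ∨ α = (-1) ^ t) ∧
    α + ((n * t + t + 1) * x ^ (n * t + t) + c * (t + 1) * x ^ t) = 0 ∧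
    z = x * (α + x ^ t * (x ^ (n * t) + c))}

theorem finite_criticalPoints {t n : ℕ} {c : ℂ} (ht : 0 < t) (hc : c = 0 ↔ n = 0) (α : ℂ) :
    {x : ℂ | α + ((n * t + t + 1) * x ^ (n * t + t) + c * (t + 1) * x ^ t) = 0}.Finite := by
  let p : Polynomial ℂ := Polynomial.C α + (Polynomial.C (n * t + t + 1 : ℂ) *
    Polynomial.X ^ (n * t + t) + Polynomial.C (c * (t + 1)) * Polynomial.X ^ t)
  have hp : p ≠ 0 := by
    intro h
    have h1 := congrArg (fun q => Polynomial.coeff q (n * t + t)) h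
    have h2 : (n * t + t + 1 : ℂ) ≠ 0 := by exact_mod_cast (n * t + t).succ_ne_zero
    have h3 : n * t + t ≠ 0 := by omega
    -- The two powers of `x` coincide when `n = 0`; then `c = 0` keeps the top coefficient from
    -- cancelling.
    have h4 : c = 0 ∨ n * t + t ≠ t := by
      rcases Nat.eq_zero_or_pos n with h | h
      · exact Or.inl (hc.2 h)
      · right
        have := Nat.mul_pos h ht
        omega
    simp only [p, Polynomial.coeff_add, Polynomial.coeff_C, h3, Polynomial.coeff_C_mul,
      Polynomial.coeff_X_pow, if_true, if_false, Polynomial.coeff_zero] at h1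
    rcases h4 with h4 | h4
    · exact h2 (by simpa [h4] using h1)
    · exact h2 (by
        simpa only [if_neg h4, mul_zero, mul_one, add_zero, zero_add] using h1)
  refine (p.rootSet_finite ℂ).subset fun x hx => ?_
  rw [Polynomial.mem_rootSet]
  refine ⟨hp, ?_⟩
  simpa [p] using hx

theorem finite_nonzeroCriticalValues {t n : ℕ} {c : ℂ} (ht : 0 < t) (hc : c = 0 ↔ n = 0) :
    (nonzeroCriticalValues t n c).Finite := by
  refine (((finite_criticalPoints ht hc 0).image
    fun x => x * (0 + x ^ t * (x ^ (n * t) + c))).union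
    ((finite_criticalPoints ht hc ((-1) ^ t)).image
    fun x => x * ((-1) ^ t + x ^ t * (x ^ (n * t) + c)))).subset ?_
  rintro z ⟨x, α, -, rfl | rfl, h, rfl⟩
  · exact Or.inl ⟨x, h, rfl⟩
  · exact Or.inr ⟨x, h, rfl⟩

/-- Value and derivative both zero give `(n+1) x^(nt) = -c` and `(n+1) α = -n c x^t`. For `n > 0`
the first yields `‖x‖ ≤ 1`, so `‖α‖ = 1` would mean `n + 1 ≤ n`, while `α = 0` contradicts `c x ≠
0`. -/
theorem zero_notMem_nonzeroCriticalValues {t n : ℕ} {c : ℂ} (ht : 0 < t) (hc : c = 0 ↔ n = 0)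
    (hc1 : ‖c‖ ≤ 1) : (0 : ℂ) ∉ nonzeroCriticalValues t n c := by
  rintro ⟨x, α, hx, hα, h1, h2⟩
  have h2 := (mul_eq_zero.1 h2.symm).resolve_left hx
  have htC : (t : ℂ) ≠ 0 := by exact_mod_cast ht.ne'
  have h3 : (t * x ^ t) * ((n + 1) * x ^ (n * t) + c) = 0 := by
    rw [pow_add] at h1
    linear_combination h1 - h2
  have h3 := (mul_eq_zero.1 h3).resolve_left (mul_ne_zero htC (pow_ne_zero _ hx))
  rcases Nat.eq_zero_or_pos n with hn | hn
  · simp [hn, hc.2 hn] at h3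
  have hc0 : c ≠ 0 := fun h => hn.ne' (hc.1 h)
  have h4 : (n + 1) * α = - (x ^ t * c * n) := by
    linear_combination (n + 1) * h2 - x ^ t * h3
  rcases hα with rfl | rfl
  · rw [mul_zero, eq_comm, neg_eq_zero] at h4
    have : (n : ℂ) ≠ 0 := by exact_mod_cast hn.ne'
    exact mul_ne_zero (mul_ne_zero (pow_ne_zero _ hx) hc0) this h4
  · have hn1 : ‖(n + 1 : ℂ)‖ = n + 1 := by
      rw [← Nat.cast_add_one, Complex.norm_natCast, Nat.cast_add_one]
    have h5 := congrArg norm h4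
    simp only [norm_mul, norm_neg, norm_pow, norm_one, one_pow, mul_one, Complex.norm_natCast,
      hn1] at h5
    have h6 := congrArg norm (eq_neg_of_add_eq_zero_left h3)
    simp only [norm_mul, norm_neg, norm_pow, hn1] at h6
    have h7 : ‖x‖ ≤ 1 := by
      by_contra! h
      have h8 := one_lt_pow₀ h (Nat.mul_pos hn ht).ne'
      have : (0 : ℝ) ≤ n := n.cast_nonneg
      nlinarith
    have h9 : ‖x‖ ^ t * ‖c‖ * n ≤ 1 * n :=
      mul_le_mul_of_nonneg_right (mul_le_one₀ (pow_le_one₀ (norm_nonneg _) h7) (norm_nonneg _) hc1)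
        n.cast_nonneg
    linarith

/-- A vanishing `y`-derivative leaves `y^δ = s^δ` or `y = 0`, whence the two values of `α`. The
`x`-derivative rules out `s = 0`, and scaling by `s` makes `x / s` a critical point. -/
theorem pencilForm_eq_criticalValue {t n : ℕ} {c : ℂ} (ht : 0 < t) (hc : c = 0 ↔ n = 0)
    {x y s : ℂ} (hx : x ≠ 0) (hy : x * (y ^ (n + 1) - s ^ (n + 1)) ^ (t - 1) * y ^ n = 0)
    (h : (y ^ (n + 1) - s ^ (n + 1)) ^ t + ((n * t + t + 1) * x ^ (n * t + t) +
      c * (t + 1) * x ^ t * s ^ (n * t)) = 0) :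
    s ≠ 0 ∧ ∃ z ∈ nonzeroCriticalValues t n c,
      x * pencilForm t n c x y s = s ^ (n * t + t + 1) * z := by
  have hα : ∃ α : ℂ, (α = 0 ∨ α = (-1) ^ t) ∧
      (y ^ (n + 1) - s ^ (n + 1)) ^ t = α * s ^ (n * t + t) := by
    rcases mul_eq_zero.1 hy with h1 | h1
    · have := eq_zero_of_pow_eq_zero ((mul_eq_zero.1 h1).resolve_left hx)
      exact ⟨0, Or.inl rfl, by rw [this, zero_pow ht.ne', zero_mul]⟩
    · have := eq_zero_of_pow_eq_zero h1
      refine ⟨(-1) ^ t, Or.inr rfl, ?_⟩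
      rw [this, zero_pow n.succ_ne_zero, zero_sub, neg_pow, ← pow_mul]
      ring_nf
  obtain ⟨α, hα, ha⟩ := hα
  rw [ha] at h
  have hs : s ≠ 0 := by
    rintro rfl
    have h1 : c * (0 : ℂ) ^ (n * t) = 0 := by
      rcases Nat.eq_zero_or_pos n with hn | hn
      · rw [hc.2 hn, zero_mul]
      · rw [zero_pow (Nat.mul_pos hn ht).ne', mul_zero]
    have h2 : (n * t + t + 1 : ℂ) ≠ 0 := by exact_mod_cast (n * t + t).succ_ne_zero
    rw [zero_pow (by omega : n * t + t ≠ 0)] at h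
    exact mul_ne_zero h2 (pow_ne_zero (n * t + t) hx)
      (by linear_combination h - (t + 1) * x ^ t * h1)
  refine ⟨hs, _, ⟨x / s, α, div_ne_zero hx hs, hα, ?_, rfl⟩, ?_⟩
  · apply (mul_eq_zero.1 (?_ : s ^ (n * t + t) * _ = 0)).resolve_left (pow_ne_zero _ hs)
    rw [← h, div_pow, div_pow, pow_add s]
    field_simp
  · rw [pencilForm, ha, pow_succ, pow_add s, div_pow, div_pow]
    field_simp

theorem pencilForm_ne_zero {t n : ℕ} (ht : 0 < t) (c : ℂ) :
    pencilForm t n c 0 0 1 ≠ 0 := by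
  simp [pencilForm, ht.ne']

/-! ### Singular points of the threefold -/

/-- The threefold `x₀ F + x₁ G` with `F` and `G` of the form `pencilForm`. -/
noncomputable def pencilThreefold (t n : ℕ) (c μ : ℂ) : MvPolynomial (Fin 5) ℂ :=
  X 0 * pencilForm t n (C c) (X 0) (X 2) (X 4) +
    X 1 * (C μ * pencilForm t n (C c) (X 1) (X 3) (X 4))

theorem eval_pencilThreefold (t n : ℕ) (c μ : ℂ) (v : Fin 5 → ℂ) :
    eval v (pencilThreefold t n c μ) = v 0 * pencilForm t n c (v 0) (v 2) (v 4) +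
      μ * (v 1 * pencilForm t n c (v 1) (v 3) (v 4)) := by
  simp only [pencilThreefold, map_add, map_mul, map_pencilForm, eval_X, eval_C]
  ring

theorem eval_pderiv_X_mul_pencilForm {σ : Type*} {t n : ℕ} (c : ℂ) {i j k : σ}
    (hij : i ≠ j) (hik : i ≠ k) (v : σ → ℂ) :
    eval v (pderiv i (X i * pencilForm t n (C c) (X i) (X j) (X k))) =
      (v j ^ (n + 1) - v k ^ (n + 1)) ^ t + ((n * t + t + 1) * v i ^ (n * t + t) +
        c * (t + 1) * v i ^ t * v k ^ (n * t)) := by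
  have e : X i * pencilForm t n (C c) (X i) (X j) (X k) =
      X i * (X j ^ (n + 1) - X k ^ (n + 1)) ^ t + X i ^ (n * t + t + 1) +
        C c * (X i ^ (t + 1) * X k ^ (n * t)) := by
    rw [pencilForm]; ring
  rw [e]
  simp [pderiv_X_of_ne hij.symm, pderiv_X_of_ne hik.symm, Derivation.leibniz_pow]
  ring

theorem eval_pderiv_X_mul_pencilForm' {σ : Type*} {t n : ℕ} (c : ℂ) {i j k : σ}
    (hij : i ≠ j) (hjk : j ≠ k) (v : σ → ℂ) :
    eval v (pderiv j (X i * pencilForm t n (C c) (X i) (X j) (X k))) =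
      t * (n + 1) * (v i * (v j ^ (n + 1) - v k ^ (n + 1)) ^ (t - 1) * v j ^ n) := by
  simp [pencilForm, pderiv_X_of_ne hij, pderiv_X_of_ne hjk.symm, Derivation.leibniz_pow]
  ring

theorem pderiv_pencilForm_eq_zero {σ : Type*} {t n : ℕ} (c : ℂ) {i j k l : σ}
    (hi : i ≠ l) (hj : j ≠ l) (hk : k ≠ l) :
    pderiv l (pencilForm t n (C c) (X i) (X j) (X k)) = 0 := by
  simp [pencilForm, pderiv_X_of_ne hi, pderiv_X_of_ne hj, pderiv_X_of_ne hk,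
    Derivation.leibniz_pow]

theorem pencilThreefold_singular_iff {t n : ℕ} {c μ : ℂ} (ht : 0 < t) (hc : c = 0 ↔ n = 0)
    (hc1 : ‖c‖ ≤ 1) (hμ : μ ≠ 0)
    (hμC : ∀ z ∈ nonzeroCriticalValues t n c, ∀ w ∈ nonzeroCriticalValues t n c, z + μ * w ≠ 0)
    (v : Fin 5 → ℂ) :
    (eval v (pencilThreefold t n c μ) = 0 ∧
      ∀ i, eval v (pderiv i (pencilThreefold t n c μ)) = 0) ↔
    v 0 = 0 ∧ v 1 = 0 ∧ v 2 ^ (n + 1) = v 4 ^ (n + 1) ∧ v 3 ^ (n + 1) = v 4 ^ (n + 1) := by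
  constructor
  · rintro ⟨hf, hd⟩
    have htn : (t : ℂ) * (n + 1) ≠ 0 :=
      mul_ne_zero (by exact_mod_cast ht.ne') (by exact_mod_cast n.succ_ne_zero)
    have e : pencilThreefold t n c μ = X 0 * pencilForm t n (C c) (X 0) (X 2) (X 4) +
      C μ * (X 1 * pencilForm t n (C c) (X 1) (X 3) (X 4)) := by rw [pencilThreefold]; ring
    have h0 := hd 0
    have h1 := hd 1
    have h2 := hd 2
    have h3 := hd 3
    rw [e, map_add, map_add, pderiv_C_mul, (eval v).map_mul, eval_C,
      eval_pderiv_X_mul_pencilForm c (by decide)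
      (by decide), Derivation.leibniz, pderiv_pencilForm_eq_zero c (by decide) (by decide)
      (by decide), pderiv_X_of_ne (by decide)] at h0
    rw [e, map_add, map_add, pderiv_C_mul, (eval v).map_mul, eval_C,
      eval_pderiv_X_mul_pencilForm c (by decide)
      (by decide), Derivation.leibniz, pderiv_pencilForm_eq_zero c (by decide) (by decide)
      (by decide), pderiv_X_of_ne (by decide)] at h1
    rw [e, map_add, map_add, pderiv_C_mul, (eval v).map_mul, eval_C,
      eval_pderiv_X_mul_pencilForm' c (by decide)
      (by decide), Derivation.leibniz, pderiv_pencilForm_eq_zero c (by decide) (by decide)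
      (by decide), pderiv_X_of_ne (by decide)] at h2
    rw [e, map_add, map_add, pderiv_C_mul, (eval v).map_mul, eval_C,
      eval_pderiv_X_mul_pencilForm' c (by decide)
      (by decide), Derivation.leibniz, pderiv_pencilForm_eq_zero c (by decide) (by decide)
      (by decide), pderiv_X_of_ne (by decide)] at h3
    simp only [smul_zero, add_zero, zero_add, map_zero, mul_zero, mul_eq_zero_iff_left htn,
      mul_eq_zero_iff_left hμ] at h0 h1 h2 h3
    rw [eval_pencilThreefold] at hf
    have hC0 := zero_notMem_nonzeroCriticalValues ht hc hc1
    -- One nonzero coordinate would make `0` a critical value; two would give `z + μ w = 0`. The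
    -- derivative in `x₄` is not needed.
    have key : v 0 = 0 ∧ v 1 = 0 := by
      by_cases hx : v 0 = 0 <;> by_cases hy : v 1 = 0
      · exact ⟨hx, hy⟩
      · obtain ⟨hs, w, hw, hw'⟩ := pencilForm_eq_criticalValue ht hc hy h3 h1
        rw [hx, hw', zero_mul, zero_add, mul_eq_zero_iff_left hμ,
          mul_eq_zero_iff_left (pow_ne_zero _ hs)] at hf
        exact absurd (hf ▸ hw) hC0
      · obtain ⟨hs, w, hw, hw'⟩ := pencilForm_eq_criticalValue ht hc hx h2 h0
        rw [hy, hw', zero_mul, mul_zero, add_zero,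
          mul_eq_zero_iff_left (pow_ne_zero _ hs)] at hf
        exact absurd (hf ▸ hw) hC0
      · obtain ⟨hs, z, hz, hz'⟩ := pencilForm_eq_criticalValue ht hc hx h2 h0
        obtain ⟨-, w, hw, hw'⟩ := pencilForm_eq_criticalValue ht hc hy h3 h1
        rw [hz', hw'] at hf
        refine absurd ?_ (hμC z hz w hw)
        refine (mul_eq_zero_iff_left (pow_ne_zero (n * t + t + 1) hs)).1 ?_
        rw [← hf]; ring
    obtain ⟨hx, hy⟩ := key
    have hnt : n * t + t ≠ 0 := by omega
    simp only [hx, hy, zero_pow hnt, zero_pow ht.ne', mul_zero, zero_mul, add_zero] at h0 h1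
    exact ⟨hx, hy, sub_eq_zero.1 (eq_zero_of_pow_eq_zero h0),
      sub_eq_zero.1 (eq_zero_of_pow_eq_zero h1)⟩
  · rintro ⟨h0, h1, h2, h3⟩
    have hF : pencilForm t n c (v 0) (v 2) (v 4) = 0 := by simp [pencilForm, h0, h2, ht.ne']
    have hG : pencilForm t n c (v 1) (v 3) (v 4) = 0 := by simp [pencilForm, h1, h3, ht.ne']
    refine ⟨by rw [eval_pencilThreefold, hF, hG]; ring, fun i => ?_⟩
    simp only [pencilThreefold, Derivation.leibniz, map_add, smul_eq_mul, map_mul,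
      map_pencilForm, eval_X, eval_C, hF, hG]
    rw [h0, h1]
    ring

/-! ### Irreducibility -/

theorem Polynomial.irreducible_X_pow_add_C {K : Type*} [Field K] {d : ℕ} (hd : 0 < d)
    {g : Polynomial K} (h0 : g.coeff 0 = 0) (h1 : g.coeff 1 ≠ 0) :
    Irreducible (Polynomial.X ^ d + Polynomial.C g) := by
  have hmonic : (Polynomial.X ^ d + Polynomial.C g).Monic :=
    Polynomial.monic_X_pow_add (Polynomial.degree_C_le.trans_lt (by exact_mod_cast hd))
  have hdeg : (Polynomial.X ^ d + Polynomial.C g).degree = (d : WithBot ℕ) :=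
    Polynomial.degree_X_pow_add_C hd g
  have hP : (Ideal.span {(Polynomial.X : Polynomial K)}).IsPrime :=
    (Ideal.span_singleton_prime Polynomial.X_ne_zero).2 Polynomial.prime_X
  refine Polynomial.irreducible_of_eisenstein_criterion hP ?_ ?_ ?_ ?_ hmonic.isPrimitive
  · rw [hmonic.leadingCoeff]
    exact (Ideal.ne_top_iff_one _).1 hP.ne_top
  · intro k hk
    rw [hdeg, Nat.cast_lt] at hk
    rw [Polynomial.coeff_add, Polynomial.coeff_X_pow, if_neg hk.ne, zero_add, Polynomial.coeff_C]
    split_ifs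
    · rw [Ideal.mem_span_singleton, Polynomial.X_dvd_iff, h0]
    · exact Ideal.zero_mem _
  · rw [hdeg]
    exact_mod_cast hd
  · rw [Polynomial.coeff_add, Polynomial.coeff_X_pow, if_neg hd.ne, zero_add, Polynomial.coeff_C_zero,
      Ideal.span_singleton_pow, Ideal.mem_span_singleton, Polynomial.X_pow_dvd_iff]
    exact fun h => h1 (h 1 one_lt_two)

theorem irreducible_pencilThreefold {t n : ℕ} {c μ : ℂ} (ht : 0 < t) (hc : c = 0 ↔ n = 0)
    (hμ : μ ≠ 0) : Irreducible (pencilThreefold t n c μ) := by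
  rw [← MulEquiv.irreducible_iff (finSuccEquiv ℂ 4)]
  let u : MvPolynomial (Fin 4) ℂ := (X 1 ^ (n + 1) - X 3 ^ (n + 1)) ^ t
  let w : MvPolynomial (Fin 4) ℂ := C c * X 3 ^ (n * t)
  let g : MvPolynomial (Fin 4) ℂ := C μ * (X 0 * pencilForm t n (C c) (X 0) (X 2) (X 3))
  have hX : ∀ i : Fin 4, finSuccEquiv ℂ 4 (X i.succ) = Polynomial.C (X i) :=
    fun i => finSuccEquiv_X_succ
  have h1 := hX 0
  have h2 := hX 1
  have h3 := hX 2
  have h4 := hX 3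
  have hC : ∀ a : ℂ, finSuccEquiv ℂ 4 (C a) = Polynomial.C (C a) := fun a =>
    finSuccEquiv_apply ℂ 4 (C a) ▸ by simp
  have e : finSuccEquiv ℂ 4 (pencilThreefold t n c μ) = Polynomial.X ^ (n * t + t + 1) +
      (Polynomial.C u * Polynomial.X + Polynomial.C w * Polynomial.X ^ (t + 1) +
        Polynomial.C g) := by
    simp only [Fin.succ_zero_eq_one, Fin.succ_one_eq_two, Fin.reduceSucc] at h1 h2 h3 h4
    simp only [pencilThreefold, map_add, map_mul, map_pencilForm, hC, h1, h2, h3, h4,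
      finSuccEquiv_X_zero, u, w, g]
    simp only [pencilForm, map_sub, map_pow]
    ring
  have hmonic : (finSuccEquiv ℂ 4 (pencilThreefold t n c μ)).Monic := by
    rw [e]
    apply Polynomial.monic_X_pow_add
    refine (Polynomial.degree_add_le _ _).trans_lt (max_lt
      ((Polynomial.degree_add_le _ _).trans_lt (max_lt ?_ ?_)) ?_)
    · refine (Polynomial.degree_C_mul_X_le _).trans_lt ?_
      exact_mod_cast (by omega : 1 < n * t + t + 1)
    · rcases Nat.eq_zero_or_pos n with hn | hn
      · simp only [w, hc.2 hn, map_zero, zero_mul, Polynomial.degree_zero]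
        exact WithBot.bot_lt_coe _
      · have := Nat.mul_pos hn ht
        refine (Polynomial.degree_C_mul_X_pow_le _ _).trans_lt ?_
        exact_mod_cast (by omega : t + 1 < n * t + t + 1)
    · refine Polynomial.degree_C_le.trans_lt ?_
      exact_mod_cast Nat.succ_pos _
  -- Setting `x₂ = x₄ = 0`, `x₃ = 1` and keeping `x₁` as `X` leaves `x₀^d + μ (X + X^d)` with `d =
  -- nt + t + 1`, which is Eisenstein at `X`.
  let ψ : MvPolynomial (Fin 4) ℂ →ₐ[ℂ] Polynomial ℂ := aeval ![Polynomial.X, 0, 1, 0]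
  refine Polynomial.Monic.irreducible_of_irreducible_map ψ.toRingHom _ hmonic ?_
  have hcn : c * (0 : ℂ) ^ (n * t) = 0 := by
    rcases Nat.eq_zero_or_pos n with hn | hn
    · rw [hc.2 hn, zero_mul]
    · rw [zero_pow (Nat.mul_pos hn ht).ne', mul_zero]
  have hcn' : Polynomial.C c * (0 : Polynomial ℂ) ^ (n * t) = 0 := by
    rw [← Polynomial.C_0, ← Polynomial.C_pow, ← Polynomial.C_mul, hcn]
  have hψC : ∀ a : ℂ, ψ (C a) = Polynomial.C a := fun a => by simp [ψ, Polynomial.algebraMap_eq]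
  have hψ0 : ψ (X 0) = Polynomial.X := by simp [ψ]
  have hψ1 : ψ (X 1) = 0 := by simp [ψ]
  have hψ2 : ψ (X 2) = 1 := by simp [ψ]
  have hψ3 : ψ (X 3) = 0 := by simp [ψ]
  have hu : ψ u = 0 := by simp [u, hψ1, hψ3, ht.ne']
  have hw : ψ w = 0 := by simp only [w, map_mul, map_pow, hψC, hψ3, hcn']
  have hg : ψ g = Polynomial.C μ * Polynomial.X + Polynomial.C μ * Polynomial.X ^ (n * t + t + 1) := by
    simp only [g, map_mul, map_pencilForm, hψC, hψ0, hψ2, hψ3]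
    simp only [pencilForm, hcn', one_pow, zero_pow n.succ_ne_zero, sub_zero, add_zero]
    ring
  have e2 : (finSuccEquiv ℂ 4 (pencilThreefold t n c μ)).map ψ.toRingHom =
      Polynomial.X ^ (n * t + t + 1) + Polynomial.C (ψ g) := by
    rw [e]
    simp [hu, hw]
  rw [e2, hg]
  apply Polynomial.irreducible_X_pow_add_C (Nat.succ_pos _)
  · simp
  · have : ¬ (n * t + t = 0) := by omega
    simp [Polynomial.coeff_X_pow, ht.ne', hμ]

/-! ### Tangent cones -/

theorem exists_X_add_C_pow_sub_one {σ K : Type*} [Field K] {n : ℕ} {ζ : K} (hζ : ζ ^ (n + 1) = 1)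
    (j : σ) : ∃ w : MvPolynomial σ K, eval 0 w = (n + 1) * ζ ^ n ∧
      (X j + C ζ) ^ (n + 1) - 1 = X j * w := by
  refine ⟨∑ i ∈ Finset.range (n + 1), (X j + C ζ) ^ i * (C ζ) ^ (n + 1 - 1 - i), ?_, ?_⟩
  · simp only [map_sum, map_mul, map_pow, map_add, eval_X, eval_C, Pi.zero_apply, zero_add]
    rw [Finset.sum_congr rfl (g := fun _ => ζ ^ n), Finset.sum_const, Finset.card_range,
      nsmul_eq_mul, Nat.cast_succ]
    intro i hi
    rw [← pow_add]
    congr 1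
    have := Finset.mem_range.1 hi
    omega
  · have h := geom_sum₂_mul (X j + C ζ) (C ζ : MvPolynomial σ K) (n + 1)
    rw [← C_pow, hζ, C_1, add_sub_cancel_right] at h
    rw [← h, mul_comm]

theorem homogeneousComponent_X_mul_pencilForm {σ : Type*} {t n : ℕ} {c ζ : ℂ}
    (hζ : ζ ^ (n + 1) = 1) (i j : σ) :
    (∀ l < t + 1, homogeneousComponent l
      (X i * pencilForm t n (C c) (X i) (X j + C ζ) 1) = 0) ∧
    homogeneousComponent (t + 1) (X i * pencilForm t n (C c) (X i) (X j + C ζ) 1) =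
      X i * X j ^ t * C (((n + 1) * ζ ^ n) ^ t) + X i ^ (t + 1) * C (0 ^ (n * t) + c) := by
  obtain ⟨w, hw, h⟩ := exists_X_add_C_pow_sub_one hζ j
  have e : X i * pencilForm t n (C c) (X i) (X j + C ζ) 1 =
      X i * X j ^ t * w ^ t + X i ^ (t + 1) * (X i ^ (n * t) + C c) := by
    rw [pencilForm, one_pow, h]
    ring
  have h1 : (X i * X j ^ t : MvPolynomial σ ℂ).IsHomogeneous (t + 1) := by
    rw [add_comm]
    exact (isHomogeneous_X _ i).mul (isHomogeneous_X_pow j t)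
  have h2 : (X i ^ (t + 1) : MvPolynomial σ ℂ).IsHomogeneous (t + 1) := isHomogeneous_X_pow i _
  rw [e]
  constructor
  · intro l hl
    rw [map_add, homogeneousComponent_mul_of_lt h1 _ hl, homogeneousComponent_mul_of_lt h2 _ hl,
      add_zero]
  · rw [map_add, homogeneousComponent_mul_self h1, homogeneousComponent_mul_self h2]
    simp only [map_pow, map_add, hw, eval_X, eval_C, Pi.zero_apply]

theorem isSmoothForm_tangentCone {σ : Type} {t : ℕ} (ht : 0 < t) {a b a' b' : ℂ} (ha : a ≠ 0)
    (hb : b ≠ 0) (ha' : a' ≠ 0) (hb' : b' ≠ 0) {i j i' j' : σ} (hij : i ≠ j) (hii' : i ≠ i')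
    (hij' : i ≠ j') (hji' : j ≠ i') (hjj' : j ≠ j') (hi'j' : i' ≠ j')
    (hall : ∀ k, k = i ∨ k = j ∨ k = i' ∨ k = j') :
    IsSmoothForm (X i * X j ^ t * C a + X i ^ (t + 1) * C b +
      (X i' * X j' ^ t * C a' + X i' ^ (t + 1) * C b')) (t + 1) := by
  classical
  have hhom : ∀ (p q : σ) (r s : ℂ), (X p * X q ^ t * C r + X p ^ (t + 1) * C s :
      MvPolynomial σ ℂ).IsHomogeneous (t + 1) := by
    intro p q r s
    have h := ((isHomogeneous_X ℂ p).mul (isHomogeneous_X_pow q t)).C_mul r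
    rw [add_comm 1 t] at h
    rw [mul_comm _ (C r), mul_comm _ (C s)]
    exact h.add (isHomogeneous_C_mul_X_pow s p (t + 1))
  have htC : (t : ℂ) ≠ 0 := by exact_mod_cast ht.ne'
  have htC' : (t + 1 : ℂ) ≠ 0 := by exact_mod_cast t.succ_ne_zero
  -- The `y`-derivative kills `x` or `y`; the `x`-derivative then kills the other.
  have key : ∀ x y r s : ℂ, r ≠ 0 → s ≠ 0 → r * y ^ t + s * ((t + 1) * x ^ t) = 0 →
      r * (x * (t * y ^ (t - 1))) = 0 → x = 0 ∧ y = 0 := by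
    intro x y r s hr hs h1 h2
    have h3 : x = 0 ∨ y = 0 := by
      rcases mul_eq_zero.1 ((mul_eq_zero.1 h2).resolve_left hr) with h | h
      · exact Or.inl h
      · exact Or.inr (eq_zero_of_pow_eq_zero ((mul_eq_zero.1 h).resolve_left htC))
    rcases h3 with rfl | rfl
    · simp only [zero_pow ht.ne', mul_zero, add_zero, mul_eq_zero, hr, false_or] at h1
      exact ⟨rfl, eq_zero_of_pow_eq_zero h1⟩
    · simp only [zero_pow ht.ne', mul_zero, zero_add, mul_eq_zero, hs, htC', false_or] at h1
      exact ⟨eq_zero_of_pow_eq_zero h1, rfl⟩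
  refine ⟨(hhom _ _ _ _).add (hhom _ _ _ _), ?_, ?_⟩
  · intro h
    have h1 := congrArg (eval (Pi.single i 1)) h
    simp [Pi.single_apply, hij.symm, hii'.symm, ht.ne', hb] at h1
  · intro v hv _
    by_contra! hd
    have d1 := hd i
    have d2 := hd j
    have d3 := hd i'
    have d4 := hd j'
    simp [Derivation.leibniz_pow, pderiv_X_of_ne hij.symm, pderiv_X_of_ne hii'.symm,
      pderiv_X_of_ne hij'.symm] at d1
    simp [Derivation.leibniz_pow, pderiv_X_of_ne hij, pderiv_X_of_ne hji'.symm,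
      pderiv_X_of_ne hjj'.symm] at d2
    simp [Derivation.leibniz_pow, pderiv_X_of_ne hii', pderiv_X_of_ne hji',
      pderiv_X_of_ne hi'j'.symm] at d3
    simp [Derivation.leibniz_pow, pderiv_X_of_ne hij', pderiv_X_of_ne hjj',
      pderiv_X_of_ne hi'j'] at d4
    obtain ⟨h1, h2⟩ := key (v i) (v j) a b ha hb (by linear_combination d1) (by simp; tauto)
    obtain ⟨h3, h4⟩ := key (v i') (v j') a' b' ha' hb' (by linear_combination d3) (by simp; tauto)
    apply hv
    ext k
    rcases hall k with rfl | rfl | rfl | rfl <;> assumption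

theorem isOrdinaryPoint_pencilThreefold {t n : ℕ} {c μ : ℂ} (ht : 0 < t) (hc : c = 0 ↔ n = 0)
    (hμ : μ ≠ 0) {p : ProjSpace 4} (h0 : p.rep 0 = 0) (h1 : p.rep 1 = 0)
    (h2 : p.rep 2 ^ (n + 1) = p.rep 4 ^ (n + 1)) (h3 : p.rep 3 ^ (n + 1) = p.rep 4 ^ (n + 1)) :
    IsOrdinaryPoint (pencilThreefold t n c μ) (t + 1) p := by
  have h4 : p.rep 4 ≠ 0 := by
    intro h4
    rw [h4, zero_pow n.succ_ne_zero] at h2 h3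
    apply p.rep_nonzero
    ext i
    fin_cases i
    exacts [h0, h1, eq_zero_of_pow_eq_zero h2, eq_zero_of_pow_eq_zero h3, h4]
  have hζ : (p.rep 2 / p.rep 4) ^ (n + 1) = 1 := by
    rw [div_pow, h2, div_self (pow_ne_zero _ h4)]
  have hξ : (p.rep 3 / p.rep 4) ^ (n + 1) = 1 := by
    rw [div_pow, h3, div_self (pow_ne_zero _ h4)]
  generalize hζ' : p.rep 2 / p.rep 4 = ζ at hζ
  generalize hξ' : p.rep 3 / p.rep 4 = ξ at hξ
  let x : {j : Fin 5 // j ≠ 4} := ⟨0, by decide⟩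
  let y : {j : Fin 5 // j ≠ 4} := ⟨1, by decide⟩
  let z : {j : Fin 5 // j ≠ 4} := ⟨2, by decide⟩
  let w : {j : Fin 5 // j ≠ 4} := ⟨3, by decide⟩
  have e : localEquation (pencilThreefold t n c μ) p.rep 4 =
      X x * pencilForm t n (C c) (X x) (X z + C ζ) 1 +
        C μ * (X y * pencilForm t n (C c) (X y) (X w + C ξ) 1) := by
    have hC : ∀ (g : Fin 5 → MvPolynomial {j : Fin 5 // j ≠ 4} ℂ) (a : ℂ), aeval g (C a) = C a :=
      fun g a => by rw [aeval_C]; rfl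
    simp only [localEquation, pencilThreefold, map_add, map_mul, map_pencilForm, aeval_X, hC]
    rw [dif_neg x.2, dif_neg y.2, dif_neg z.2, dif_neg w.2, dif_pos trivial, h0, h1, hζ', hξ']
    simp only [zero_div, C_0, add_zero, x, y, z, w]
    ring
  obtain ⟨hl, hm⟩ := homogeneousComponent_X_mul_pencilForm (t := t) (c := c) hζ x z
  obtain ⟨hl', hm'⟩ := homogeneousComponent_X_mul_pencilForm (t := t) (c := c) hξ y w
  have hn1 : (n + 1 : ℂ) ≠ 0 := by exact_mod_cast n.succ_ne_zero
  have hunit : ∀ a : ℂ, a ^ (n + 1) = 1 → ((n + 1) * a ^ n) ^ t ≠ 0 := by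
    intro a ha
    have : a ≠ 0 := by
      rintro rfl
      simp at ha
    exact pow_ne_zero _ (mul_ne_zero hn1 (pow_ne_zero _ this))
  -- This coefficient of `x^(t+1)` is `1` if `n = 0`, since `0 ^ 0 = 1`, and `c` otherwise.
  have hcc : (0 : ℂ) ^ (n * t) + c ≠ 0 := by
    rcases Nat.eq_zero_or_pos n with hn | hn
    · simp [hn, hc.2 hn]
    · rw [zero_pow (Nat.mul_pos hn ht).ne', zero_add]
      exact fun h => hn.ne' (hc.1 h)
  refine ⟨t.succ_pos, 4, h4, fun l hl1 => ?_, ?_⟩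
  · rw [e, map_add, homogeneousComponent_C_mul, hl l hl1, hl' l hl1, mul_zero, add_zero]
  · rw [e, map_add, homogeneousComponent_C_mul, hm, hm']
    convert isSmoothForm_tangentCone ht (hunit ζ hζ) hcc (mul_ne_zero hμ (hunit ξ hξ))
      (mul_ne_zero hμ hcc) (i := x) (j := z) (i' := y) (j' := w) (by decide) (by decide)
      (by decide) (by decide) (by decide) (by decide) (by decide) using 1
    simp only [C_mul]
    ring

/-! ### Counting the singular points and assembling the example -/

theorem singularLocus_pencilThreefold {t n : ℕ} {c μ : ℂ}
    (h : ∀ v : Fin 5 → ℂ, (eval v (pencilThreefold t n c μ) = 0 ∧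
      ∀ i, eval v (pderiv i (pencilThreefold t n c μ)) = 0) ↔
      v 0 = 0 ∧ v 1 = 0 ∧ v 2 ^ (n + 1) = v 4 ^ (n + 1) ∧ v 3 ^ (n + 1) = v 4 ^ (n + 1)) :
    (singularLocus (n := 4) (pencilThreefold t n c μ)).encard = (((n + 1) ^ 2 : ℕ) : ℕ∞) := by
  classical
  have hne : ∀ z : ℂ × ℂ, (![0, 0, z.1, z.2, 1] : Fin 5 → ℂ) ≠ 0 := fun z hz =>
    one_ne_zero (α := ℂ) (congrFun hz 4)
  let φ : ℂ × ℂ → ProjSpace 4 := fun z => Projectivization.mk ℂ _ (hne z)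
  have hφ : Function.Injective φ := by
    intro z w hzw
    obtain ⟨a, ha⟩ := (Projectivization.mk_eq_mk_iff' ℂ _ _ _ _).1 hzw
    have e2 := congrFun ha 2
    have e3 := congrFun ha 3
    have e4 := congrFun ha 4
    simp at e2 e3 e4
    subst e4
    exact Prod.ext (by simpa using e2.symm) (by simpa using e3.symm)
  let S : Finset ℂ := Polynomial.nthRootsFinset (n + 1) 1
  have hS : ∀ x, x ∈ S ↔ x ^ (n + 1) = 1 := fun x => Polynomial.mem_nthRootsFinset n.succ_pos 1
  have hcard : S.card = n + 1 :=
    (Complex.isPrimitiveRoot_exp (n + 1) n.succ_ne_zero).card_nthRootsFinset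
  have himage : singularLocus (n := 4) (pencilThreefold t n c μ) = φ '' ↑(S ×ˢ S) := by
    ext p
    refine (h p.rep).trans ⟨?_, ?_⟩
    · rintro ⟨h0, h1, h2, h3⟩
      have h4 : p.rep 4 ≠ 0 := by
        intro h4
        rw [h4, zero_pow n.succ_ne_zero] at h2 h3
        apply p.rep_nonzero
        ext i
        fin_cases i
        exacts [h0, h1, eq_zero_of_pow_eq_zero h2, eq_zero_of_pow_eq_zero h3, h4]
      refine ⟨(p.rep 2 / p.rep 4, p.rep 3 / p.rep 4), ?_, ?_⟩
      · rw [Finset.mem_coe, Finset.mem_product, hS, hS, div_pow, div_pow, h2, h3,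
          div_self (pow_ne_zero _ h4)]
        exact ⟨rfl, rfl⟩
      · refine Eq.trans ?_ p.mk_rep
        refine (Projectivization.mk_eq_mk_iff' ℂ _ _ _ _).2 ⟨(p.rep 4)⁻¹, ?_⟩
        ext i
        fin_cases i <;> simp [h0, h1, h4, div_eq_inv_mul]
    · rintro ⟨z, hz, rfl⟩
      rw [Finset.mem_coe, Finset.mem_product, hS, hS] at hz
      obtain ⟨a, ha⟩ := Projectivization.exists_smul_eq_mk_rep ℂ _ (hne z)
      show (φ z).rep 0 = 0 ∧ _
      rw [← show _ = (φ z).rep from ha]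
      simp [Units.smul_def, mul_pow, hz.1, hz.2]
  rw [himage, hφ.encard_image, Set.encard_coe_eq_coe_finsetCard, Finset.card_product, hcard, sq]

theorem exists_generic_scalar {S : Set ℂ} (hS : S.Finite) (h0 : (0 : ℂ) ∉ S) :
    ∃ μ : ℂ, μ ≠ 0 ∧ ∀ z ∈ S, ∀ w ∈ S, z + μ * w ≠ 0 := by
  obtain ⟨μ, hμ⟩ := (((hS.prod hS).image fun q => -q.1 / q.2).insert 0).exists_notMem
  refine ⟨μ, fun h => hμ (Or.inl h), fun z hz w hw h => hμ (Or.inr ⟨(z, w), ⟨hz, hw⟩, ?_⟩)⟩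
  have : w ≠ 0 := fun h => h0 (h ▸ hw)
  show -z / w = μ
  rw [div_eq_iff this]
  linear_combination -h

theorem mainTheorem7 (t δ : ℕ) (ht : 0 < t) (hδ : 0 < δ) :
    ∃ F G f : MvPolynomial (Fin 5) ℂ,
      F.IsHomogeneous (δ * t) ∧ G.IsHomogeneous (δ * t) ∧
      f = MvPolynomial.X 0 * F + MvPolynomial.X 1 * G ∧
      f.IsHomogeneous (δ * t + 1) ∧ Irreducible f ∧
      homogeneousIdeal (hypersurface (n := 4) f) = Ideal.span {f} ∧
      ¬ IsFactorialVariety (hypersurface (n := 4) f) ∧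
      (singularLocus (n := 4) f).encard = ((δ ^ 2 : ℕ) : ℕ∞) ∧
      (∀ p ∈ singularLocus (n := 4) f, IsOrdinaryPoint f (t + 1) p) ∧
      {p : ProjSpace 4 | p.rep 0 = 0 ∧ p.rep 1 = 0} ⊆ hypersurface (n := 4) f := by
  obtain ⟨n, rfl⟩ := Nat.exists_eq_succ_of_ne_zero hδ.ne'
  obtain ⟨c, hc, hc1⟩ : ∃ c : ℂ, (c = 0 ↔ n = 0) ∧ ‖c‖ ≤ 1 :=
    ⟨if n = 0 then 0 else 1, by simp, by split_ifs <;> simp⟩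
  obtain ⟨μ, hμ, hμC⟩ := exists_generic_scalar (finite_nonzeroCriticalValues ht hc)
    (zero_notMem_nonzeroCriticalValues ht hc hc1)
  have hsing := pencilThreefold_singular_iff ht hc hc1 hμ hμC
  have hirr := irreducible_pencilThreefold ht hc hμ
  have hF := isHomogeneous_pencilForm t n c (0 : Fin 5) 2 4
  have hG := (isHomogeneous_pencilForm t n c (1 : Fin 5) 3 4).C_mul μ
  have hf : (pencilThreefold t n c μ).IsHomogeneous ((n + 1) * t + 1) := by
    rw [add_comm]
    exact ((isHomogeneous_X ℂ 0).mul hF).add ((isHomogeneous_X ℂ 1).mul hG)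
  have hcard := singularLocus_pencilThreefold hsing
  have hne : (hypersurface (n := 4) (pencilThreefold t n c μ)).Nonempty := by
    obtain ⟨p, hp⟩ : (singularLocus (n := 4) (pencilThreefold t n c μ)).Nonempty := by
      rw [← Set.encard_ne_zero, hcard]
      exact_mod_cast pow_ne_zero 2 n.succ_ne_zero
    exact ⟨p, hp.1⟩
  have hideal := homogeneousIdeal_hypersurface hf hirr hne
  -- The singularity criterion at the vertex of the affine cone says that `f` has no constant or
  -- linear part.
  obtain ⟨hv0, hv1⟩ := (hsing 0).2 (by simp)
  refine ⟨_, _, pencilThreefold t n c μ, hF, hG, rfl, hf, hirr, hideal, ?_, hcard, ?_, ?_⟩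
  · unfold IsFactorialVariety homogeneousCoordinateRing
    rw [hideal]
    have hρC : ∀ a : ℂ, aeval ![0, 0, X 2, X 3, X 4] (C a) = (C a : MvPolynomial (Fin 5) ℂ) :=
      fun a => by rw [aeval_C]; rfl
    refine not_uniqueFactorizationMonoid_quotient (show (0 : Fin 5) ≠ 1 by decide) rfl hv0 hv1
      (aeval ![0, 0, X 2, X 3, X 4]) (by simp) (by simp) ?_ ?_
    · intro h
      rw [map_mul, map_pencilForm, hρC, hρC] at h
      -- At this point of the plane `G` equals `μ (-1)^t`.
      have h1 := congrArg (eval ![0, 0, 0, 0, 1]) h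
      simp only [map_mul, map_pencilForm, eval_C, map_zero, aeval_X] at h1
      exact mul_ne_zero hμ (pencilForm_ne_zero (n := n) ht c) (by simpa using h1)
    · intro g hg
      have h1 := congrArg (eval 0) hg
      refine Eq.trans ?_ (h1.trans (map_zero _))
      have h2 : ((aeval (0 : Fin 5 → ℂ)).comp
          (aeval ![0, 0, X 2, X 3, X 4] : MvPolynomial (Fin 5) ℂ →ₐ[ℂ] _)) = aeval 0 := by
        ext i
        fin_cases i <;> simp
      exact (DFunLike.congr_fun h2 g).symm
  · intro p hp
    obtain ⟨h0, h1, h2, h3⟩ := (hsing p.rep).1 hp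
    exact isOrdinaryPoint_pencilThreefold ht hc hμ h0 h1 h2 h3
  · rintro p ⟨h0, h1⟩
    show eval p.rep _ = 0
    rw [eval_pencilThreefold, h0, h1]
    ring
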